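/- **Setting.** Fix the computational (reference) basis of each space $\mathbb C^n$, and the product basis on tensor products. Let $\Delta$ be the completely dephasing map, which deletes all off-diagonal matrix entries. An incoherent state is a diagonal density matrix. An operator $K$ is incoherent if $K\rho K^\dagger$ is diagonal, i.e. a (possibly zero) multiple of an incoherent state, for every incoherent state $\rho$. Among the quantum channels (completely positive trace-preserving maps), DIO is the class of those $\mathcal E$ with $\Delta\circ\mathcal E=\mathcal E\circ\Delta$; IO is the class of those with a finite Kraus decomposition $\mathcal E(\cdot)=\sum_l K_l\cdot K_l^\dagger$ in which all $K_l$ are incoherent; SIO is the class of those with a finite Kraus decomposition in which all $K_l$ and all $K_l^\dagger$ are incoherent. For $m\ge 1$ let $\Psi_m=|\Psi_m\rangle\langle\Psi_m|$ with $|\Psi_m\rangle=m^{-1/2}\sum_{i=1}^m|i\rangle$. For a density matrix $\rho$ on $A=\mathbb C^d$, a class $\mathcal O\in\{\mathrm{DIO},\mathrm{IO},\mathrm{SIO}\}$ and $\varepsilon\ge 0$, let $P_{\mathcal O}(\rho\to\Psi_m,\varepsilon)$ be the maximal $p\in[0,1]$ for which there are a channel $\Pi\in\mathcal O$ from $A$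 to $L\otimes B=\mathbb C^2\otimes\mathbb C^m$ and density matrices $\sigma,\omega$ on $B$ with $$\Pi(\rho)=p\,|0\rangle\langle 0|_L\otimes\sigma+(1-p)\,|1\rangle\langle 1|_L\otimes\omega,\qquad F(\sigma,\Psi_m)\ge 1-\varepsilon,$$ where $F(\rho,\sigma)=\|\sqrt\rho\sqrt\sigma\|_1^2$ is the fidelity. **Theorem.** Let $d\ge 1$ and $m\ge 1$ be integers and let $\varphi=|\varphi\rangle\langle\varphi|$ be a pure state, with $|\varphi\rangle\in\mathbb C^d$ a unit vector. Then the maxima defining $P_{\mathrm{DIO}}(\varphi\to\Psi_m,0)$, $P_{\mathrm{SIO}}(\varphi\to\Psi_m,0)$ and $P_{\mathrm{IO}}(\varphi\to\Psi_m,0)$ are attained, and $$P_{\mathrm{DIO}}(\varphi\to\Psi_m,0)=P_{\mathrm{SIO}}(\varphi\to\Psi_m,0)=P_{\mathrm{IO}}(\varphi\to\Psi_m,0).$$ -/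

import Mathlib

open scoped MatrixOrder Kronecker ComplexOrder

namespace Coherence

noncomputable section

/-- Linear maps ("superoperators") from operators on `ℂ^ι` to operators on `ℂ^κ`; operators are
written as matrices in the fixed reference (incoherent) basis. -/
abbrev SuperOp (ι κ : Type*) : Type _ := Matrix ι ι ℂ →ₗ[ℂ] Matrix κ κ ℂ

/-- Density operators: positive semidefinite with unit trace. -/
def IsDensity {ι : Type*} [Fintype ι] (ρ : Matrix ι ι ℂ) : Prop :=
  ρ.PosSemidef ∧ ρ.trace = 1

/-- The completely dephasing map `Δ`, which erases all off-diagonal entries. -/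
def dephasing (ι : Type*) [DecidableEq ι] : SuperOp ι ι where
  toFun A := Matrix.diagonal A.diag
  map_add' A B := by
    ext i j
    by_cases h : i = j <;> simp [h]
  map_smul' c A := by
    ext i j
    by_cases h : i = j <;> simp [h]

/-- Incoherent states: density operators that are diagonal in the reference basis. -/
def IsIncoherentState {ι : Type*} [Fintype ι] (ρ : Matrix ι ι ℂ) : Prop :=
  IsDensity ρ ∧ ρ.IsDiag

/-- The amplification `id_n ⊗ Φ`, acting on operators on `ℂ^n ⊗ ℂ^ι` block by block. -/
def amplify {ι κ : Type*} (n : ℕ) (Φ : SuperOp ι κ)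
    (M : Matrix (Fin n × ι) (Fin n × ι) ℂ) : Matrix (Fin n × κ) (Fin n × κ) ℂ :=
  Matrix.of fun x y => Φ (Matrix.of fun i j => M (x.1, i) (y.1, j)) x.2 y.2

/-- Complete positivity: every amplification `id_n ⊗ Φ` preserves positive semidefiniteness. -/
def IsCompletelyPositive {ι κ : Type*} [Fintype ι] [Fintype κ] (Φ : SuperOp ι κ) : Prop :=
  ∀ (n : ℕ) (M : Matrix (Fin n × ι) (Fin n × ι) ℂ), M.PosSemidef → (amplify n Φ M).PosSemidef

/-- Quantum operations (channels): completely positive trace-preserving maps. -/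
def IsChannel {ι κ : Type*} [Fintype ι] [Fintype κ] (Φ : SuperOp ι κ) : Prop :=
  IsCompletelyPositive Φ ∧ ∀ A, (Φ A).trace = A.trace

/-- `K` is an incoherent operator: it maps every incoherent state to a multiple (possibly zero) of
an incoherent state. Since `K ρ K†` is always positive semidefinite, this says that it is diagonal;
the normalization by the trace is left out, so no division by zero occurs. -/
def IsIncoherentOperator {ι κ : Type*} [Fintype ι] [Fintype κ] (K : Matrix κ ι ℂ) : Prop :=
  ∀ ρ : Matrix ι ι ℂ, IsIncoherentState ρ → (K * ρ * K.conjTranspose).IsDiag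

/-- `K` is a (finite) Kraus decomposition of `Φ`. -/
def IsKrausOf {ι κ : Type*} [Fintype ι] {r : ℕ} (K : Fin r → Matrix κ ι ℂ)
    (Φ : SuperOp ι κ) : Prop :=
  ∀ A, Φ A = ∑ l, K l * A * (K l).conjTranspose

/-- Dephasing-covariant incoherent operations: channels commuting with `Δ`. -/
def dephasingCovariantOps (ι κ : Type*) [Fintype ι] [Fintype κ] [DecidableEq ι] [DecidableEq κ] :
    Set (SuperOp ι κ) :=
  {Φ | IsChannel Φ ∧ dephasing κ ∘ₗ Φ = Φ ∘ₗ dephasing ι}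

/-- Incoherent operations: channels with a Kraus decomposition into incoherent operators. -/
def incoherentOps (ι κ : Type*) [Fintype ι] [Fintype κ] : Set (SuperOp ι κ) :=
  {Φ | IsChannel Φ ∧ ∃ (r : ℕ) (K : Fin r → Matrix κ ι ℂ), IsKrausOf K Φ ∧
    ∀ l, IsIncoherentOperator (K l)}

/-- Strictly incoherent operations: channels with a Kraus decomposition `{K_l}` such that all `K_l`
and all adjoints `K_l†` are incoherent operators. -/
def strictlyIncoherentOps (ι κ : Type*) [Fintype ι] [Fintype κ] : Set (SuperOp ι κ) :=
  {Φ | IsChannel Φ ∧ ∃ (r : ℕ) (K : Fin r → Matrix κ ι ℂ), IsKrausOf K Φ ∧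
    ∀ l, IsIncoherentOperator (K l) ∧ IsIncoherentOperator (K l).conjTranspose}

/-- The trace norm `‖A‖₁ = tr √(A† A)`. -/
def traceNorm {ι : Type*} [Fintype ι] [DecidableEq ι] (A : Matrix ι ι ℂ) : ℝ :=
  (CFC.sqrt (A.conjTranspose * A)).trace.re

/-- The fidelity `F(ρ, σ) = ‖√ρ √σ‖₁²`. -/
def fidelity {ι : Type*} [Fintype ι] [DecidableEq ι] (ρ σ : Matrix ι ι ℂ) : ℝ :=
  traceNorm (CFC.sqrt ρ * CFC.sqrt σ) ^ 2

/-- The projector `|v⟩⟨v|`. -/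
def ketbra {ι : Type*} (v : EuclideanSpace ℂ ι) : Matrix ι ι ℂ :=
  Matrix.vecMulVec (fun i => v i) (fun i => star (v i))

/-- The vector `|Ψ_m⟩ = m^{-1/2} ∑_i |i⟩` (`m ≥ 1`). -/
def maxCoherentVec (m : ℕ) : EuclideanSpace ℂ (Fin m) :=
  WithLp.toLp 2 fun _ => (((Real.sqrt m)⁻¹ : ℝ) : ℂ)

/-- The maximally coherent state `Ψ_m = |Ψ_m⟩⟨Ψ_m|`. -/
def maxCoherentState (m : ℕ) : Matrix (Fin m) (Fin m) ℂ := ketbra (maxCoherentVec m)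

/-- The probabilities `p` with which `Ψ_m` can be distilled from `ρ` with infidelity at most `ε` by
an operation `A → LB` in the class `O`. The index set `Fin 2 × Fin m` is the product basis of the
flag register `L` and the output system `B`; flag `0` signals success. -/
def distillationProbs {ι : Type*} [Fintype ι] (m : ℕ)
    (O : Set (SuperOp ι (Fin 2 × Fin m))) (ρ : Matrix ι ι ℂ) (ε : ℝ) : Set ℝ :=
  {p | 0 ≤ p ∧ p ≤ 1 ∧ ∃ Φ ∈ O, ∃ σ ω : Matrix (Fin m) (Fin m) ℂ,
    IsDensity σ ∧ IsDensity ω ∧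
    Φ ρ = (p : ℂ) • (Matrix.single (0 : Fin 2) (0 : Fin 2) (1 : ℂ) ⊗ₖ σ)
      + ((1 - p : ℝ) : ℂ) • (Matrix.single (1 : Fin 2) (1 : Fin 2) (1 : ℂ) ⊗ₖ ω) ∧
    1 - ε ≤ fidelity σ (maxCoherentState m)}

/-- The maximal success probability `P_O(ρ → Ψ_m, ε)`. -/
def maxSuccessProb {ι : Type*} [Fintype ι] (m : ℕ)
    (O : Set (SuperOp ι (Fin 2 × Fin m))) (ρ : Matrix ι ι ℂ) (ε : ℝ) : ℝ :=
  sSup (distillationProbs m O ρ ε)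

end

end Coherence

/-!
The three classes achieve exactly the same success probabilities, namely the `p ∈ [0, 1]` with
`p ≤ ∑ i, min (|φ i|²) (p / m)` (`distillationProbs_eq`). This condition is closed and satisfied by
`p = 0`, so each maximum is attained, and the maxima agree. Since SIO is contained in both IO and
DIO, three facts suffice. In all of them `ε = 0` forces the successful output to be `Ψ_m` itself
(`eq_maxCoherentState_of_one_le_fidelity`).

* Converse for DIO (`le_sum_min_of_mem_dephasingCovariant`). The Heisenberg dual of the channel
  pulls "success" back to a diagonal matrix `N`, with `0 ≤ N ≤ 1`, and "success and `Ψ_m`" to a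
  positive semidefinite `M ≤ N` with diagonal `N / m`. As `⟨φ, M φ⟩ = ⟨φ, N φ⟩ = p`, one has
  `M φ = N φ`, and Cauchy–Schwarz for `M` yields `N i i * |φ i|² ≤ p / m`; summing over `i` gives
  the bound.
* Converse for IO (`le_sum_min_of_mem_incoherent`). Let `S` be the set of `i` with
  `|φ i|² > p / m`. Each incoherent Kraus operator sends the basis vectors of `S` to at most `#S`
  of the `m` successful outcomes, so the other outcomes, which carry at least the fraction
  `(m - #S) / m` of the success probability, are produced by the part of `φ` outside `S`.
* Achievability by SIO (`mem_distillationProbs_of_le_sum_min`). Rescaling the truncated weights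
  `min (|φ i|²) (p / m)` to total mass `p` gives `p / m` times a point of a hypersimplex. By
  Birkhoff's theorem this point is a mixture of indicators of `m`-element sets
  (`exists_convexCombination_injections`), and each such set gives one strictly incoherent Kraus
  operator that flattens `φ` on it to a multiple of `|Ψ_m⟩`.
-/

namespace Coherence

/-! ### The maximally coherent state and its fidelity -/

lemma maxCoherentState_apply (m : ℕ) (a b : Fin m) : maxCoherentState m a b = (m : ℂ)⁻¹ := by
  have h : ((Real.sqrt m : ℝ) : ℂ) * ((Real.sqrt m : ℝ) : ℂ) = m := by
    rw [← Complex.ofReal_mul, Real.mul_self_sqrt (Nat.cast_nonneg m), Complex.ofReal_natCast]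
  simp [maxCoherentState, ketbra, maxCoherentVec, Matrix.vecMulVec_apply, ← mul_inv, h]

lemma ketbra_posSemidef {ι : Type*} [Fintype ι] (v : EuclideanSpace ℂ ι) :
    (ketbra v).PosSemidef :=
  Matrix.posSemidef_vecMulVec_self_star (fun i => v i)

lemma maxCoherentState_posSemidef (m : ℕ) : (maxCoherentState m).PosSemidef :=
  ketbra_posSemidef _

lemma trace_maxCoherentState {m : ℕ} (hm : 1 ≤ m) : (maxCoherentState m).trace = 1 := by
  have : (m : ℂ) ≠ 0 := by exact_mod_cast (by omega : m ≠ 0)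
  simp [Matrix.trace, maxCoherentState_apply, this]

lemma maxCoherentState_mul_mul (m : ℕ) (A : Matrix (Fin m) (Fin m) ℂ) :
    maxCoherentState m * A * maxCoherentState m
      = (maxCoherentState m * A).trace • maxCoherentState m := by
  ext a b
  simp only [Matrix.mul_apply, Matrix.smul_apply, maxCoherentState_apply, Matrix.trace,
    Matrix.diag_apply, smul_eq_mul, Finset.sum_mul]

lemma maxCoherentState_mul_self {m : ℕ} (hm : 1 ≤ m) :
    maxCoherentState m * maxCoherentState m = maxCoherentState m := by
  have h := maxCoherentState_mul_mul m 1
  simpa [trace_maxCoherentState hm] using h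

lemma sqrt_maxCoherentState {m : ℕ} (hm : 1 ≤ m) :
    CFC.sqrt (maxCoherentState m) = maxCoherentState m :=
  CFC.sqrt_unique (maxCoherentState_mul_self hm) (maxCoherentState_posSemidef m).nonneg

/-- The trace of a product of two positive semidefinite matrices is nonnegative. -/
lemma trace_mul_nonneg {κ : Type*} [Fintype κ] {X Y : Matrix κ κ ℂ}
    (hX : X.PosSemidef) (hY : Y.PosSemidef) : 0 ≤ (X * Y).trace := by
  classical
  obtain ⟨B, rfl⟩ := CStarAlgebra.nonneg_iff_eq_star_mul_self.mp hX.nonneg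
  rw [mul_assoc, Matrix.trace_mul_comm]
  exact (hY.mul_mul_conjTranspose_same B).trace_nonneg

lemma fidelity_maxCoherentState {m : ℕ} (hm : 1 ≤ m) {σ : Matrix (Fin m) (Fin m) ℂ}
    (hσ : σ.PosSemidef) :
    fidelity σ (maxCoherentState m) = ((maxCoherentState m * σ).trace).re := by
  have hψ := (maxCoherentState_posSemidef m).isHermitian.eq
  have hS : (CFC.sqrt σ).conjTranspose = CFC.sqrt σ :=
    (Matrix.nonneg_iff_posSemidef.mp (CFC.sqrt_nonneg σ)).isHermitian.eq
  have hc := trace_mul_nonneg (maxCoherentState_posSemidef m) hσ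
  obtain ⟨hre, him⟩ := Complex.nonneg_iff.mp hc
  have hcc : (maxCoherentState m * σ).trace = (((maxCoherentState m * σ).trace.re : ℝ) : ℂ) :=
    Complex.ext (by simp) (by simp [← him])
  set c := (maxCoherentState m * σ).trace.re
  have hsq : (CFC.sqrt σ * maxCoherentState m).conjTranspose * (CFC.sqrt σ * maxCoherentState m)
      = (c : ℂ) • maxCoherentState m := by
    rw [← hcc, ← maxCoherentState_mul_mul, Matrix.conjTranspose_mul, hψ, hS,
      mul_assoc, ← mul_assoc (CFC.sqrt σ), CFC.sqrt_mul_sqrt_self σ hσ.nonneg, mul_assoc]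
  have hroot : CFC.sqrt ((c : ℂ) • maxCoherentState m)
      = ((Real.sqrt c : ℝ) : ℂ) • maxCoherentState m := by
    refine CFC.sqrt_unique ?_ ?_
    · rw [smul_mul_smul_comm, maxCoherentState_mul_self hm, ← Complex.ofReal_mul,
        Real.mul_self_sqrt hre]
    · exact ((maxCoherentState_posSemidef m).smul
        (Complex.zero_le_real.mpr (Real.sqrt_nonneg c))).nonneg
  rw [fidelity, sqrt_maxCoherentState hm, traceNorm, hsq, hroot, Matrix.trace_smul,
    trace_maxCoherentState hm]
  simp [Real.sq_sqrt hre]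

/-- Only `Ψ_m` itself has fidelity one with `Ψ_m`: the defect `1 - F(σ, Ψ_m)` is the squared
Hilbert–Schmidt norm of `(1 - Ψ_m) √σ`. -/
lemma eq_maxCoherentState_of_one_le_fidelity {m : ℕ} (hm : 1 ≤ m)
    {σ : Matrix (Fin m) (Fin m) ℂ} (hσ : IsDensity σ)
    (hF : 1 ≤ fidelity σ (maxCoherentState m)) : σ = maxCoherentState m := by
  obtain ⟨hσ, htr⟩ := hσ
  rw [fidelity_maxCoherentState hm hσ] at hF
  have hψ := (maxCoherentState_posSemidef m).isHermitian.eq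
  have hS : (CFC.sqrt σ).conjTranspose = CFC.sqrt σ :=
    (Matrix.nonneg_iff_posSemidef.mp (CFC.sqrt_nonneg σ)).isHermitian.eq
  have hPP : (1 - maxCoherentState m) * (1 - maxCoherentState m) = 1 - maxCoherentState m := by
    rw [mul_sub, sub_mul, sub_mul, maxCoherentState_mul_self hm]; simp
  set S := CFC.sqrt σ with hSdef
  have hSS : S * S = σ := CFC.sqrt_mul_sqrt_self σ hσ.nonneg
  have htrace : (((1 - maxCoherentState m) * S).conjTranspose
      * ((1 - maxCoherentState m) * S)).trace = 1 - (maxCoherentState m * σ).trace := by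
    rw [Matrix.conjTranspose_mul, Matrix.conjTranspose_sub, hψ, hS, Matrix.conjTranspose_one,
      mul_assoc, ← mul_assoc (1 - maxCoherentState m), hPP, Matrix.trace_mul_comm, mul_assoc,
      hSS, sub_mul, Matrix.trace_sub, one_mul, htr]
  have hnn := (Matrix.posSemidef_conjTranspose_mul_self
    ((1 - maxCoherentState m) * S)).trace_nonneg
  have hzero : (((1 - maxCoherentState m) * S).conjTranspose
      * ((1 - maxCoherentState m) * S)).trace = 0 := by
    refine le_antisymm ?_ hnn
    rw [htrace, Complex.nonneg_iff] at hnn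
    rw [htrace, Complex.le_def]
    exact ⟨by simpa using hF, hnn.2.symm⟩
  have hone : (maxCoherentState m * σ).trace = 1 := by
    rw [htrace] at hzero; exact (sub_eq_zero.mp hzero).symm
  rw [Matrix.trace_conjTranspose_mul_self_eq_zero_iff, sub_mul, one_mul, sub_eq_zero] at hzero
  have hleft : maxCoherentState m * σ = σ := by rw [← hSS, ← mul_assoc, ← hzero]
  have hright : σ * maxCoherentState m = σ := by
    have := congrArg Matrix.conjTranspose hleft
    rwa [Matrix.conjTranspose_mul, hψ, hσ.isHermitian.eq] at this
  have h := maxCoherentState_mul_mul m σ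
  rwa [hone, hleft, hright, one_smul] at h

lemma fidelity_maxCoherentState_self {m : ℕ} (hm : 1 ≤ m) :
    fidelity (maxCoherentState m) (maxCoherentState m) = 1 := by
  rw [fidelity_maxCoherentState hm (maxCoherentState_posSemidef m), maxCoherentState_mul_self hm,
    trace_maxCoherentState hm, Complex.one_re]

lemma isDensity_maxCoherentState {m : ℕ} (hm : 1 ≤ m) : IsDensity (maxCoherentState m) :=
  ⟨maxCoherentState_posSemidef m, trace_maxCoherentState hm⟩

/-! ### Heisenberg duals and positivity -/

/-- The matrix `Φ†(X)` of the Heisenberg dual of `Φ`: `tr (Φ†(X) A) = tr (X Φ(A))`. -/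
noncomputable def dualMatrix {ι κ : Type*} [Fintype κ] [DecidableEq ι] (Φ : SuperOp ι κ)
    (X : Matrix κ κ ℂ) : Matrix ι ι ℂ :=
  Matrix.of fun i j => (X * Φ (Matrix.single j i 1)).trace

lemma dualMatrix_apply {ι κ : Type*} [Fintype κ] [DecidableEq ι] (Φ : SuperOp ι κ)
    (X : Matrix κ κ ℂ) (i j : ι) :
    dualMatrix Φ X i j = (X * Φ (Matrix.single j i 1)).trace := rfl

lemma dualMatrix_sub {ι κ : Type*} [Fintype κ] [DecidableEq ι] (Φ : SuperOp ι κ)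
    (X Y : Matrix κ κ ℂ) : dualMatrix Φ (X - Y) = dualMatrix Φ X - dualMatrix Φ Y := by
  ext i j
  simp [dualMatrix_apply, sub_mul]

lemma star_dotProduct_dualMatrix_mulVec {ι κ : Type*} [Fintype ι] [Fintype κ] [DecidableEq ι]
    (Φ : SuperOp ι κ) (X : Matrix κ κ ℂ) (v : EuclideanSpace ℂ ι) :
    (star (fun i => v i)) ⬝ᵥ (dualMatrix Φ X).mulVec (fun i => v i)
      = (X * Φ (ketbra v)).trace := by
  have h : ketbra v = ∑ j, ∑ i, (v j * star (v i)) • Matrix.single j i (1 : ℂ) := by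
    conv_lhs => rw [Matrix.matrix_eq_sum_single (ketbra v)]
    simp [ketbra, Matrix.vecMulVec_apply]
  rw [h]
  simp only [map_sum, map_smul, Matrix.mul_smul, Matrix.trace_sum,
    Matrix.trace_smul, dotProduct, Matrix.mulVec, dualMatrix_apply, Finset.mul_sum, Pi.star_apply,
    smul_eq_mul]
  rw [Finset.sum_comm]
  exact Finset.sum_congr rfl fun j _ => Finset.sum_congr rfl fun i _ => by ring

/-- A complex matrix with nonnegative quadratic form is Hermitian, by polarization, hence positive
semidefinite. -/
lemma posSemidef_of_star_dotProduct_nonneg {ι : Type*} [Fintype ι] {M : Matrix ι ι ℂ}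
    (h : ∀ v : EuclideanSpace ℂ ι, 0 ≤ star (fun i => v i) ⬝ᵥ M.mulVec (fun i => v i)) :
    M.PosSemidef := by
  classical
  rw [← Matrix.isPositive_toEuclideanLin_iff, LinearMap.isPositive_iff_complex]
  intro x
  have hx := Complex.nonneg_iff.mp (h x)
  have hin : inner ℂ (M.toEuclideanLin x) x
      = star (star (fun i => x i) ⬝ᵥ M.mulVec (fun i => x i)) := by
    rw [EuclideanSpace.inner_eq_star_dotProduct, ← Matrix.star_dotProduct_star, star_star,
      dotProduct_comm]
    simp [Matrix.ofLp_toLpLin, Matrix.toLin'_apply]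
  rw [hin]
  refine ⟨Complex.ext ?_ ?_, ?_⟩
  · simp
  · simp [← hx.2]
  · simpa using hx.1

lemma IsCompletelyPositive.map_posSemidef {ι κ : Type*} [Fintype ι] [Fintype κ]
    {Φ : SuperOp ι κ} (h : IsCompletelyPositive Φ) {A : Matrix ι ι ℂ} (hA : A.PosSemidef) :
    (Φ A).PosSemidef :=
  (h 1 _ (hA.submatrix Prod.snd)).submatrix fun k => ((0 : Fin 1), k)

lemma dualMatrix_posSemidef {ι κ : Type*} [Fintype ι] [Fintype κ] [DecidableEq ι]
    {Φ : SuperOp ι κ} (hΦ : IsCompletelyPositive Φ) {X : Matrix κ κ ℂ} (hX : X.PosSemidef) :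
    (dualMatrix Φ X).PosSemidef := by
  refine posSemidef_of_star_dotProduct_nonneg fun v => ?_
  rw [star_dotProduct_dualMatrix_mulVec]
  exact trace_mul_nonneg hX (hΦ.map_posSemidef (ketbra_posSemidef v))

/-- The Cauchy–Schwarz inequality for the form of `M`, between a basis vector and `v`. -/
lemma norm_mulVec_sq_le {ι : Type*} [Fintype ι] {M : Matrix ι ι ℂ} (hM : M.PosSemidef)
    (v : ι → ℂ) (i : ι) :
    ‖M.mulVec v i‖ ^ 2 ≤ (M i i).re * (star v ⬝ᵥ M.mulVec v).re := by
  classical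
  obtain ⟨B, rfl⟩ := CStarAlgebra.nonneg_iff_eq_star_mul_self.mp hM.nonneg
  let b : EuclideanSpace ℂ ι := WithLp.toLp 2 fun k => B k i
  let w : EuclideanSpace ℂ ι := WithLp.toLp 2 (B.mulVec v)
  have h1 : (star B * B).mulVec v i = inner ℂ b w := by
    rw [← Matrix.mulVec_mulVec, EuclideanSpace.inner_eq_star_dotProduct, dotProduct_comm]
    rfl
  have h2 : ((star B * B) i i).re = ‖b‖ ^ 2 := by
    rw [← inner_self_eq_norm_sq (𝕜 := ℂ), EuclideanSpace.inner_eq_star_dotProduct, dotProduct_comm]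
    rfl
  have h3 : (star v ⬝ᵥ (star B * B).mulVec v).re = ‖w‖ ^ 2 := by
    rw [← inner_self_eq_norm_sq (𝕜 := ℂ), EuclideanSpace.inner_eq_star_dotProduct,
      dotProduct_comm w.ofLp, ← Matrix.mulVec_mulVec, Matrix.dotProduct_mulVec,
      Matrix.star_eq_conjTranspose, Matrix.vecMul_conjTranspose, star_star]
    rfl
  rw [h1, h2, h3, ← mul_pow]
  exact pow_le_pow_left₀ (norm_nonneg _) (norm_inner_le_norm b w) 2

/-! ### Dephasing-covariant operations: the converse -/

lemma trace_single_kronecker_mul {m : ℕ} (X : Matrix (Fin m) (Fin m) ℂ)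
    (Y : Matrix (Fin 2 × Fin m) (Fin 2 × Fin m) ℂ) :
    ((Matrix.single (0 : Fin 2) (0 : Fin 2) (1 : ℂ) ⊗ₖ X) * Y).trace
      = ∑ a, ∑ b, X a b * Y (0, b) (0, a) := by
  simp [Matrix.trace, Matrix.mul_apply, Fintype.sum_prod_type, Matrix.kroneckerMap_apply,
    Matrix.single_apply, Fin.sum_univ_two]

/-- The success block of a flagged output state is `p Ψ_m`, all of whose entries are `p / m`. -/
lemma flagged_apply {m : ℕ} (p q : ℂ) (ω : Matrix (Fin m) (Fin m) ℂ) (a b : Fin m) :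
    (p • (Matrix.single (0 : Fin 2) (0 : Fin 2) (1 : ℂ) ⊗ₖ maxCoherentState m)
      + q • (Matrix.single (1 : Fin 2) (1 : Fin 2) (1 : ℂ) ⊗ₖ ω)) (0, a) (0, b)
      = p * (m : ℂ)⁻¹ := by
  simp [Matrix.kroneckerMap_apply, maxCoherentState_apply]

/-- At `ε = 0` the success block of the output is exactly `p Ψ_m`; the converse bounds use nothing
else about the output state. -/
lemma exists_of_mem_distillationProbs {ι : Type*} [Fintype ι] {m : ℕ} (hm : 1 ≤ m)
    {O : Set (SuperOp ι (Fin 2 × Fin m))} {ρ : Matrix ι ι ℂ} {p : ℝ}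
    (h : p ∈ distillationProbs m O ρ 0) :
    0 ≤ p ∧ p ≤ 1 ∧ ∃ Φ ∈ O, ∀ a b : Fin m, Φ ρ (0, a) (0, b) = (p : ℂ) * (m : ℂ)⁻¹ := by
  obtain ⟨h0, h1, Φ, hΦ, σ, ω, hσ, -, hρ, hF⟩ := h
  rw [sub_zero] at hF
  obtain rfl := eq_maxCoherentState_of_one_le_fidelity hm hσ hF
  exact ⟨h0, h1, Φ, hΦ, fun a b => by rw [hρ, flagged_apply]⟩

/-- The dephasing-covariant case of the converse. Let `M` and `N` be the pull-backs under the
channel of "success and `Ψ_m`" and of "success". Covariance makes `N` diagonal with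
`M i i = N i i / m`, and since success yields exactly `Ψ_m`, `N - M ≥ 0` annihilates `φ`. So
`N i i * φ i = (M φ) i`, which Cauchy–Schwarz bounds by `√(N i i / m) √p`. -/
lemma le_sum_min_of_mem_dephasingCovariant {ι : Type*} [Fintype ι] [DecidableEq ι] {m : ℕ}
    (hm : 1 ≤ m) (φ : EuclideanSpace ℂ ι) {p : ℝ}
    (h : p ∈ distillationProbs m (dephasingCovariantOps ι (Fin 2 × Fin m)) (ketbra φ) 0) :
    p ≤ ∑ i, min (‖φ i‖ ^ 2) (p / m) := by
  obtain ⟨hp0, -, Φ, ⟨⟨hcp, htp⟩, hcov⟩, hout⟩ := exists_of_mem_distillationProbs hm h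
  have hm0 : (m : ℂ) ≠ 0 := by exact_mod_cast (by omega : m ≠ 0)
  have hmR : (0 : ℝ) < m := by exact_mod_cast hm
  have hE : (Matrix.single (0 : Fin 2) (0 : Fin 2) (1 : ℂ)).PosSemidef := by
    rw [← Matrix.diagonal_single]
    exact Matrix.PosSemidef.diagonal (Pi.single_nonneg.mpr zero_le_one)
  set X₁ := Matrix.single (0 : Fin 2) (0 : Fin 2) (1 : ℂ) ⊗ₖ maxCoherentState m with hX₁
  set X₂ := Matrix.single (0 : Fin 2) (0 : Fin 2) (1 : ℂ) ⊗ₖ (1 : Matrix (Fin m) (Fin m) ℂ)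
    with hX₂
  have hM := dualMatrix_posSemidef hcp (hE.kronecker (maxCoherentState_posSemidef m))
  -- `X₂ - X₁` is `|0⟩⟨0| ⊗ (1 - Ψ_m)`, a projection.
  have hsub : (X₂ - X₁).PosSemidef := by
    have : X₂ - X₁ = Matrix.single (0 : Fin 2) (0 : Fin 2) (1 : ℂ) ⊗ₖ
        ((1 - maxCoherentState m).conjTranspose * (1 - maxCoherentState m)) := by
      have hPP : (1 - maxCoherentState m).conjTranspose * (1 - maxCoherentState m)
          = 1 - maxCoherentState m := by
        rw [Matrix.conjTranspose_sub, (maxCoherentState_posSemidef m).isHermitian.eq,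
          Matrix.conjTranspose_one, mul_sub, sub_mul, sub_mul, maxCoherentState_mul_self hm]
        simp
      rw [hPP, hX₁, hX₂]
      ext ⟨a, b⟩ ⟨c, d⟩
      simp [Matrix.kroneckerMap_apply, mul_sub]
    rw [this]
    exact hE.kronecker (Matrix.posSemidef_conjTranspose_mul_self _)
  have hNM := dualMatrix_posSemidef hcp hsub
  set M := dualMatrix Φ X₁ with hMdef
  set N := dualMatrix Φ X₂ with hNdef
  rw [dualMatrix_sub, ← hMdef, ← hNdef] at hNM
  set v : ι → ℂ := fun i => φ i with hv
  have hMφ : star v ⬝ᵥ M.mulVec v = p := by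
    rw [hv, hMdef, star_dotProduct_dualMatrix_mulVec, hX₁, trace_single_kronecker_mul]
    simp only [hout, maxCoherentState_apply, Finset.sum_const, Finset.card_univ, Fintype.card_fin,
      nsmul_eq_mul]
    field_simp
  have hNφ : star v ⬝ᵥ N.mulVec v = p := by
    rw [hv, hNdef, star_dotProduct_dualMatrix_mulVec, hX₂, trace_single_kronecker_mul]
    simp only [hout, Matrix.one_apply, ite_mul, one_mul, zero_mul, Finset.sum_ite_eq,
      Finset.mem_univ, if_true, Finset.sum_const, Finset.card_univ, Fintype.card_fin,
      nsmul_eq_mul]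
    field_simp
  -- `N - M ≥ 0` has expectation `p - p = 0` in `φ`, hence annihilates it.
  have hker : N.mulVec v = M.mulVec v := by
    rw [← sub_eq_zero, ← Matrix.sub_mulVec, ← hNM.dotProduct_mulVec_zero_iff,
      Matrix.sub_mulVec, dotProduct_sub, hMφ, hNφ, sub_self]
  have hcov' : ∀ (i j : ι) (x y : Fin 2 × Fin m), dephasing _ (Φ (Matrix.single i j 1)) x y
      = Φ (dephasing _ (Matrix.single i j 1)) x y := fun i j x y =>
    congrFun (congrFun (LinearMap.congr_fun hcov (Matrix.single i j 1)) x) y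
  have hdiagN : ∀ i, N i i = ∑ a, Φ (Matrix.single i i 1) (0, a) (0, a) := fun i => by
    rw [hNdef, dualMatrix_apply, hX₂, trace_single_kronecker_mul]
    simp [Matrix.one_apply]
  have hoffN : ∀ i j, i ≠ j → N i j = 0 := fun i j hij => by
    rw [hNdef, dualMatrix_apply, hX₂, trace_single_kronecker_mul]
    simp only [Matrix.one_apply, ite_mul, one_mul, zero_mul, Finset.sum_ite_eq,
      Finset.mem_univ, if_true]
    refine Finset.sum_eq_zero fun a _ => ?_
    have := hcov' j i (0, a) (0, a)
    have hz : dephasing ι (Matrix.single j i (1 : ℂ)) = 0 := by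
      ext k l
      simp only [dephasing, LinearMap.coe_mk, AddHom.coe_mk, Matrix.diagonal_apply,
        Matrix.diag_apply, Matrix.single_apply, Matrix.zero_apply]
      grind
    rw [hz, map_zero] at this
    simpa [dephasing] using this
  have hdiagM : ∀ i, M i i = (m : ℂ)⁻¹ * N i i := fun i => by
    rw [hdiagN, hMdef, dualMatrix_apply, hX₁, trace_single_kronecker_mul, Finset.mul_sum]
    refine Finset.sum_congr rfl fun a _ => ?_
    rw [Finset.sum_eq_single a, maxCoherentState_apply]
    · intro b _ hb
      have := hcov' i i (0, b) (0, a)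
      have hz : dephasing ι (Matrix.single i i (1 : ℂ)) = Matrix.single i i 1 := by
        ext k l
        simp only [dephasing, LinearMap.coe_mk, AddHom.coe_mk, Matrix.diagonal_apply,
          Matrix.diag_apply, Matrix.single_apply]
        grind
      rw [hz] at this
      rw [← this]
      simp [dephasing, hb]
    · simp
  have hpos : ∀ i x, 0 ≤ Φ (Matrix.single i i 1) x x := fun i x => by
    refine (hcp.map_posSemidef ?_).diag_nonneg
    rw [← Matrix.diagonal_single]
    exact Matrix.PosSemidef.diagonal (Pi.single_nonneg.mpr zero_le_one)
  have hN0 : ∀ i, 0 ≤ N i i := fun i => by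
    rw [hdiagN]; exact Finset.sum_nonneg fun a _ => hpos i _
  -- The failure block contributes the rest of the unit trace of `Φ |i⟩⟨i|`.
  have hN1 : ∀ i, N i i ≤ 1 := fun i => by
    have ht := htp (Matrix.single i i 1)
    simp only [Matrix.trace, Matrix.diag_apply, Fintype.sum_prod_type, Fin.sum_univ_two] at ht
    rw [← hdiagN] at ht
    have h1 : ∑ x, Matrix.single i i (1 : ℂ) x x = 1 := by simp [Matrix.single_apply]
    rw [h1] at ht
    rw [← ht]
    exact le_add_of_nonneg_right (Finset.sum_nonneg fun a _ => hpos i _)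
  have hNv : ∀ i, N.mulVec v i = N i i * v i := fun i => by
    rw [Matrix.mulVec, dotProduct, Finset.sum_eq_single i]
    · intro j _ hj; rw [hoffN i j hj.symm, zero_mul]
    · simp
  obtain ⟨n, hn⟩ : ∃ n : ι → ℝ, ∀ i, N i i = n i :=
    ⟨fun i => (N i i).re, fun i => Complex.ext (by simp) (by
      simp [← (Complex.nonneg_iff.mp (hN0 i)).2])⟩
  have hn0 : ∀ i, 0 ≤ n i := fun i => by have := hN0 i; rw [hn] at this; exact_mod_cast this
  have hn1 : ∀ i, n i ≤ 1 := fun i => by have := hN1 i; rw [hn] at this; exact_mod_cast this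
  have hsum : p = ∑ i, n i * ‖φ i‖ ^ 2 := by
    have : (p : ℂ) = ((∑ i, n i * ‖φ i‖ ^ 2 : ℝ) : ℂ) := by
      rw [← hNφ, dotProduct]
      push_cast
      refine Finset.sum_congr rfl fun i _ => ?_
      rw [hNv, hn, ← Complex.conj_mul']
      simp [hv]; ring
    exact_mod_cast this
  conv_lhs => rw [hsum]
  refine Finset.sum_le_sum fun i _ => le_min (mul_le_of_le_one_left (sq_nonneg _) (hn1 i)) ?_
  have hcs := norm_mulVec_sq_le hM v i
  rw [← hker, hNv, hdiagM, hn, norm_mul, mul_pow, Complex.norm_real,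
    Real.norm_of_nonneg (hn0 i), ← Complex.ofReal_natCast, ← Complex.ofReal_inv,
    ← Complex.ofReal_mul, Complex.ofReal_re, hNφ, Complex.ofReal_re] at hcs
  rcases (hn0 i).eq_or_lt with h0 | h0
  · rw [← h0, zero_mul]; positivity
  · have : n i * (n i * ‖φ i‖ ^ 2) ≤ n i * (p / m) := by
      calc n i * (n i * ‖φ i‖ ^ 2) = n i ^ 2 * ‖v i‖ ^ 2 := by rw [hv]; ring
        _ ≤ _ := hcs
        _ = _ := by ring
    exact le_of_mul_le_mul_left this h0

/-! ### Incoherent operations: the converse -/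

lemma isIncoherentOperator_iff {ι κ : Type*} [Fintype ι] [Fintype κ] [DecidableEq ι]
    {K : Matrix κ ι ℂ} :
    IsIncoherentOperator K ↔ ∀ j a b, a ≠ b → K a j = 0 ∨ K b j = 0 := by
  constructor
  · intro h j a b hab
    have hρ : IsIncoherentState (Matrix.single j j (1 : ℂ)) := by
      rw [← Matrix.diagonal_single]
      exact ⟨⟨Matrix.PosSemidef.diagonal (Pi.single_nonneg.mpr zero_le_one), by simp⟩,
        Matrix.isDiag_diagonal _⟩
    have := h _ hρ hab
    simpa [Matrix.mul_apply, Matrix.single_apply, Finset.sum_mul, ite_and] using this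
  · intro h ρ hρ a b hab
    simp only [Matrix.mul_apply, Matrix.conjTranspose_apply, Finset.sum_mul]
    refine Finset.sum_eq_zero fun j _ => Finset.sum_eq_zero fun i _ => ?_
    by_cases hij : i = j
    · subst hij
      rcases h i a b hab with h | h <;> simp [h]
    · rw [hρ.2 hij]; simp

lemma mul_ketbra_mul_conjTranspose_apply {ι κ : Type*} [Fintype ι] (K : Matrix κ ι ℂ)
    (v : EuclideanSpace ℂ ι) (x y : κ) :
    (K * ketbra v * K.conjTranspose) x y
      = K.mulVec (fun i => v i) x * star (K.mulVec (fun i => v i) y) := by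
  have h : (ketbra v) * K.conjTranspose
      = Matrix.vecMulVec (fun i => v i) (star (K.mulVec fun i => v i)) := by
    rw [ketbra, Matrix.vecMulVec_mul, Matrix.star_mulVec]; rfl
  rw [Matrix.mul_assoc, h, Matrix.mul_vecMulVec]
  rfl

/-- The incoherent case of the converse. With `S` the set of large coefficients of `φ`, an
incoherent Kraus operator maps the basis vectors in `S` to at most `#S` outcomes. On the remaining
`m - #S` successful outcomes the amplitude, which is the same on all successful outcomes, comes
from the coefficients outside `S` alone. Comparing norms gives
`p (m - #S) / m ≤ ∑ i ∉ S, ‖φ i‖ ^ 2`. -/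
lemma le_sum_min_of_mem_incoherent {ι : Type*} [Fintype ι] [DecidableEq ι] {m : ℕ}
    (hm : 1 ≤ m) (φ : EuclideanSpace ℂ ι) {p : ℝ}
    (h : p ∈ distillationProbs m (incoherentOps ι (Fin 2 × Fin m)) (ketbra φ) 0) :
    p ≤ ∑ i, min (‖φ i‖ ^ 2) (p / m) := by
  obtain ⟨hp0, -, Φ, ⟨⟨-, htp⟩, r, K, hK, hinc⟩, hout⟩ := exists_of_mem_distillationProbs hm h
  have hmR : (0 : ℝ) < m := by exact_mod_cast hm
  simp only [isIncoherentOperator_iff] at hinc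
  let S : Finset ι := {i | p / m < ‖φ i‖ ^ 2}
  let v : EuclideanSpace ℂ ι := WithLp.toLp 2 fun i => if i ∈ S then 0 else φ i
  let y : Fin r → Fin m → ℂ := fun l b => (K l).mulVec (fun i => φ i) (0, b)
  let u : Fin r → Fin 2 × Fin m → ℂ := fun l x => (K l).mulVec (fun i => v i) x
  have hyy : ∀ a b, ∑ l, y l a * star (y l b) = (p : ℂ) * (m : ℂ)⁻¹ := fun a b => by
    rw [← hout a b, hK, Matrix.sum_apply]
    simp only [mul_ketbra_mul_conjTranspose_apply, y]
  -- `∑ l, |y l a - y l b|²` expands into four entries of the constant block `p Ψ_m`, and cancels.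
  have hconst : ∀ l a b, y l a = y l b := by
    intro l a b
    have h0 : ∑ l, (y l a - y l b) * star (y l a - y l b) = 0 := by
      simp only [star_sub, mul_sub, sub_mul, Finset.sum_sub_distrib, hyy, sub_self]
    rw [Finset.sum_eq_zero_iff_of_nonneg fun l _ => mul_star_self_nonneg _] at h0
    exact sub_eq_zero.mp (CStarRing.mul_star_self_eq_zero_iff _ |>.mp (h0 l (Finset.mem_univ l)))
  have hnormy : ∀ b, ∑ l, ‖y l b‖ ^ 2 = p / m := fun b => by
    have := hyy b b
    simp only [← starRingEnd_apply, Complex.mul_conj'] at this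
    have h2 : ((∑ l, ‖y l b‖ ^ 2 : ℝ) : ℂ) = ((p / m : ℝ) : ℂ) := by
      push_cast; rw [this, div_eq_mul_inv]
    exact_mod_cast h2
  -- Trace preservation, applied to the part `v` of `φ` outside `S`.
  have hnormu : ∑ l, ∑ x, ‖u l x‖ ^ 2 = ∑ i ∈ Sᶜ, ‖φ i‖ ^ 2 := by
    have ht := htp (ketbra v)
    rw [hK, Matrix.trace_sum] at ht
    simp only [Matrix.trace, Matrix.diag_apply,
      mul_ketbra_mul_conjTranspose_apply] at ht
    simp only [ketbra, Matrix.vecMulVec_apply, ← starRingEnd_apply, Complex.mul_conj'] at ht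
    have h2 : ∑ l, ∑ x, ‖u l x‖ ^ 2 = ∑ i, ‖v i‖ ^ 2 := by exact_mod_cast ht
    rw [h2, ← Finset.sum_subset (Finset.subset_univ Sᶜ)]
    · exact Finset.sum_congr rfl fun i hi => by simp [v, Finset.mem_compl.mp hi]
    · intro i _ hi
      simp [v, Finset.notMem_compl.mp hi]
  have hmin : ∑ i, min (‖φ i‖ ^ 2) (p / m) = S.card * (p / m) + ∑ i ∈ Sᶜ, ‖φ i‖ ^ 2 := by
    rw [← Finset.sum_add_sum_compl S]
    congr 1
    · rw [← nsmul_eq_mul, ← Finset.sum_const]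
      exact Finset.sum_congr rfl fun i hi => min_eq_right (Finset.mem_filter.mp hi).2.le
    · refine Finset.sum_congr rfl fun i hi => min_eq_left ?_
      simpa [S] using hi
  -- The successful outcomes that the Kraus operator `l` can reach from `S`.
  let hit : Fin r → Finset (Fin m) := fun l =>
    S.biUnion fun j => {b | K l (0, b) j ≠ 0}
  have hhit : ∀ l, (hit l).card ≤ S.card := fun l => by
    refine (Finset.card_biUnion_le_card_mul _ _ 1 fun j _ => ?_).trans (mul_one _).le
    refine Finset.card_le_one.mpr fun a ha b hb => ?_
    by_contra hab
    have := hinc l j (0, a) (0, b) (by simpa using hab)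
    simp only [Finset.mem_filter, Finset.mem_univ, true_and] at ha hb
    tauto
  have hunhit : ∀ l, ∀ b ∈ (hit l)ᶜ, u l (0, b) = y l b := fun l b hb => by
    refine Finset.sum_congr rfl fun i _ => ?_
    by_cases hi : i ∈ S
    · have : K l (0, b) i = 0 := by
        by_contra hne
        exact Finset.mem_compl.mp hb (Finset.mem_biUnion.mpr ⟨i, hi, by simpa using hne⟩)
      simp [this]
    · simp [v, hi]
  let b₀ : Fin m := ⟨0, hm⟩
  have hl : ∀ l, ((m : ℝ) - S.card) * ‖y l b₀‖ ^ 2 ≤ ∑ x, ‖u l x‖ ^ 2 := fun l => by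
    have hcard : (m : ℝ) - S.card ≤ ((hit l)ᶜ.card : ℝ) := by
      have h1 := Finset.card_compl_add_card (hit l)
      rw [Fintype.card_fin] at h1
      have h2 := hhit l
      rw [sub_le_iff_le_add]
      exact_mod_cast (by omega : m ≤ (hit l)ᶜ.card + S.card)
    calc ((m : ℝ) - S.card) * ‖y l b₀‖ ^ 2 ≤ (hit l)ᶜ.card * ‖y l b₀‖ ^ 2 := by gcongr
      _ = ∑ b ∈ (hit l)ᶜ, ‖u l (0, b)‖ ^ 2 := by
          rw [← nsmul_eq_mul, ← Finset.sum_const]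
          exact Finset.sum_congr rfl fun b hb => by rw [hunhit l b hb, hconst l b b₀]
      _ ≤ ∑ b, ‖u l (0, b)‖ ^ 2 :=
          Finset.sum_le_univ_sum_of_nonneg fun b => sq_nonneg _
      _ ≤ ∑ x, ‖u l x‖ ^ 2 := by
          rw [Fintype.sum_prod_type, Fin.sum_univ_two]
          exact le_add_of_nonneg_right (Finset.sum_nonneg fun b _ => sq_nonneg _)
  have hmain := Finset.sum_le_sum fun l (_ : l ∈ Finset.univ) => hl l
  rw [← Finset.mul_sum, hnormy, hnormu] at hmain
  rw [hmin]
  have : (m : ℝ) * (p / m) = p := by field_simp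
  linarith

/-! ### Kraus maps and inclusions between the classes -/

/-- The superoperator with Kraus operators `K`. -/
noncomputable def krausMap {ι κ L : Type*} [Fintype ι] [Fintype L] (K : L → Matrix κ ι ℂ) :
    SuperOp ι κ where
  toFun A := ∑ l, K l * A * (K l).conjTranspose
  map_add' A B := by simp [Matrix.mul_add, Matrix.add_mul, Finset.sum_add_distrib]
  map_smul' c A := by simp [Finset.smul_sum]

lemma krausMap_apply {ι κ L : Type*} [Fintype ι] [Fintype L] (K : L → Matrix κ ι ℂ)
    (A : Matrix ι ι ℂ) : krausMap K A = ∑ l, K l * A * (K l).conjTranspose := rfl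

lemma isCompletelyPositive_krausMap {ι κ L : Type*} [Fintype ι] [Fintype κ] [Fintype L]
    (K : L → Matrix κ ι ℂ) : IsCompletelyPositive (krausMap K) := by
  intro n M hM
  have h : amplify n (krausMap K) M
      = ∑ l, ((1 : Matrix (Fin n) (Fin n) ℂ) ⊗ₖ K l) * M
          * ((1 : Matrix (Fin n) (Fin n) ℂ) ⊗ₖ K l).conjTranspose := by
    ext ⟨a, x⟩ ⟨b, y⟩
    simp [amplify, krausMap_apply, Matrix.sum_apply, Matrix.mul_apply, Fintype.sum_prod_type,
      Matrix.kroneckerMap_apply, Matrix.one_apply, Finset.sum_mul, Finset.sum_ite_irrel,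
      apply_ite (starRingEnd ℂ)]
  rw [h]
  exact Matrix.posSemidef_sum _ fun l _ => hM.mul_mul_conjTranspose_same _

lemma krausMap_mem_strictlyIncoherentOps {ι κ L : Type*} [Fintype ι] [Fintype κ] [Fintype L]
    [DecidableEq ι] {K : L → Matrix κ ι ℂ} (hK : ∑ l, (K l).conjTranspose * K l = 1)
    (hinc : ∀ l, IsIncoherentOperator (K l) ∧ IsIncoherentOperator (K l).conjTranspose) :
    krausMap K ∈ strictlyIncoherentOps ι κ := by
  refine ⟨⟨isCompletelyPositive_krausMap K, fun A => ?_⟩, Fintype.card L,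
    fun i => K ((Fintype.equivFin L).symm i), fun A => ?_, fun i => hinc _⟩
  · rw [krausMap_apply, Matrix.trace_sum]
    simp_rw [Matrix.trace_mul_comm _ (Matrix.conjTranspose _), ← Matrix.mul_assoc]
    rw [← Matrix.trace_sum, ← Finset.sum_mul, hK, Matrix.one_mul]
  · exact ((Fintype.equivFin L).symm.sum_comp fun l => K l * A * (K l).conjTranspose).symm

lemma strictlyIncoherentOps_subset_incoherentOps (ι κ : Type*) [Fintype ι] [Fintype κ] :
    strictlyIncoherentOps ι κ ⊆ incoherentOps ι κ :=
  fun _ ⟨h, r, K, hK, hinc⟩ => ⟨h, r, K, hK, fun l => (hinc l).1⟩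

/-- Strictly incoherent Kraus operators have at most one nonzero entry in each row and column, so
conjugation by them commutes with dephasing. -/
lemma strictlyIncoherentOps_subset_dephasingCovariantOps (ι κ : Type*) [Fintype ι] [Fintype κ]
    [DecidableEq ι] [DecidableEq κ] :
    strictlyIncoherentOps ι κ ⊆ dephasingCovariantOps ι κ := by
  rintro Φ ⟨h, r, K, hK, hinc⟩
  refine ⟨h, LinearMap.ext fun A => ?_⟩
  ext x y
  simp only [isIncoherentOperator_iff] at hinc
  have hK : ∀ A, Φ A = ∑ l, K l * A * (K l).conjTranspose := hK
  simp only [LinearMap.comp_apply, hK, dephasing, LinearMap.coe_mk, AddHom.coe_mk,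
    Matrix.diagonal_apply, Matrix.diag_apply, Matrix.sum_apply, Matrix.mul_apply,
    Matrix.conjTranspose_apply, mul_ite, mul_zero, Finset.sum_ite_eq', Finset.mem_univ, if_true,
    Finset.sum_mul]
  split_ifs with hxy
  · subst hxy
    refine Finset.sum_congr rfl fun l _ => Finset.sum_congr rfl fun i _ => ?_
    rw [Finset.sum_eq_single i]
    · intro j _ hj
      rcases (hinc l).2 x i j (Ne.symm hj) with h0 | h0 <;>
        rw [Matrix.conjTranspose_apply, star_eq_zero] at h0 <;> simp [h0]
    · simp
  · symm
    refine Finset.sum_eq_zero fun l _ => Finset.sum_eq_zero fun i _ => ?_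
    rcases (hinc l).1 i x y hxy with h0 | h0 <;> simp [h0]

lemma distillationProbs_mono {ι : Type*} [Fintype ι] {m : ℕ}
    {O O' : Set (SuperOp ι (Fin 2 × Fin m))} (h : O ⊆ O') (ρ : Matrix ι ι ℂ) (ε : ℝ) :
    distillationProbs m O ρ ε ⊆ distillationProbs m O' ρ ε :=
  fun _ ⟨h0, h1, Φ, hΦ, hrest⟩ => ⟨h0, h1, Φ, h hΦ, hrest⟩

/-! ### Strictly incoherent operations: achievability -/

/-- A point of the hypersimplex `{x ∈ [0, 1]^d | ∑ x = m}` is a convex combination of indicator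
functions of `m`-element sets, here given as ranges of injections. This is Birkhoff's theorem for
the doubly stochastic matrix with `m` rows `x / m` and `d - m` rows `(1 - x) / (d - m)`. -/
lemma exists_convexCombination_injections {d m : ℕ} (hm : 1 ≤ m) (x : Fin d → ℝ)
    (hx0 : ∀ i, 0 ≤ x i) (hx1 : ∀ i, x i ≤ 1) (hx : ∑ i, x i = m) :
    ∃ (w : Equiv.Perm (Fin d) → ℝ) (g : Equiv.Perm (Fin d) → Fin m → Fin d),
      (∀ τ, 0 ≤ w τ) ∧ ∑ τ, w τ = 1 ∧ (∀ τ, Function.Injective (g τ)) ∧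
      ∀ i, ∑ τ, w τ * ∑ k, (if g τ k = i then 1 else 0) = x i := by
  have hmd : m ≤ d := by
    have : ∑ i, x i ≤ ∑ _i : Fin d, (1 : ℝ) := Finset.sum_le_sum fun i _ => hx1 i
    rw [hx] at this
    simpa using this
  obtain ⟨e, rfl⟩ := Nat.exists_eq_add_of_le hmd
  have hm0 : (m : ℝ) ≠ 0 := by exact_mod_cast (by omega : m ≠ 0)
  have hx' : ∑ i, (1 - x i) = e := by
    rw [Finset.sum_sub_distrib, hx]; simp
  let D : Matrix (Fin (m + e)) (Fin (m + e)) ℝ := Matrix.of fun k i =>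
    Fin.addCases (fun _ => x i / m) (fun _ => (1 - x i) / e) k
  have hDl : ∀ (k : Fin m) i, D (Fin.castAdd e k) i = x i / m := fun k i => by simp [D]
  have hDr : ∀ (k : Fin e) i, D (Fin.natAdd m k) i = (1 - x i) / e := fun k i => by simp [D]
  have hD : D ∈ doublyStochastic ℝ (Fin (m + e)) := by
    rw [mem_doublyStochastic_iff_sum]
    refine ⟨fun k i => ?_, fun k => ?_, fun i => ?_⟩
    · refine Fin.addCases (fun k => ?_) (fun k => ?_) k
      · rw [hDl]; exact div_nonneg (hx0 i) (Nat.cast_nonneg m)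
      · rw [hDr]; exact div_nonneg (sub_nonneg.mpr (hx1 i)) (Nat.cast_nonneg e)
    · refine Fin.addCases (fun k => ?_) (fun k => ?_) k
      · simp only [hDl]; rw [← Finset.sum_div, hx, div_self hm0]
      · simp only [hDr]
        rw [← Finset.sum_div, hx', div_self (by exact_mod_cast k.pos.ne')]
    · rw [Fin.sum_univ_add]
      simp only [hDl, hDr, Finset.sum_const, Finset.card_univ, Fintype.card_fin, nsmul_eq_mul]
      rw [mul_div_cancel₀ _ hm0]
      -- If `e = 0` there are no rows of the second kind, and `x = 1` identically.
      rcases Nat.eq_zero_or_pos e with he | he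
      · subst he
        rw [Nat.cast_zero, Finset.sum_eq_zero_iff_of_nonneg fun i _ => sub_nonneg.mpr (hx1 i)]
          at hx'
        have := hx' i (Finset.mem_univ i)
        simp; linarith
      · have : (e : ℝ) ≠ 0 := by exact_mod_cast he.ne'
        rw [mul_div_cancel₀ _ this]; ring
  obtain ⟨w, hw0, hw1, hw⟩ := exists_eq_sum_perm_of_mem_doublyStochastic hD
  refine ⟨w, fun τ k => τ (Fin.castAdd e k), hw0, hw1,
    fun τ => τ.injective.comp (Fin.castAdd_injective m e), fun i => ?_⟩
  simp only [Finset.mul_sum]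
  rw [Finset.sum_comm]
  have : ∀ k : Fin m, ∑ τ, w τ * (if τ (Fin.castAdd e k) = i then 1 else 0) = x i / m :=
    fun k => by
      rw [← hDl k i, ← hw, Matrix.sum_apply]
      simp [Equiv.Perm.permMatrix, PEquiv.toMatrix_apply, eq_comm]
  simp only [this, Finset.sum_const, Finset.card_univ, Fintype.card_fin, nsmul_eq_mul]
  field_simp

/-- A strictly incoherent protocol. The Kraus operator of `j` sends the basis vectors in the range
of `g j` to the basis of the successful outcome, rescaled to make the amplitudes of `φ` uniform;
what is left of each basis vector is measured and flagged as a failure. -/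
lemma mem_distillationProbs_strictlyIncoherent {ι J : Type*} [Fintype ι] [DecidableEq ι]
    [Fintype J] {m : ℕ} (hm : 1 ≤ m) (φ : EuclideanSpace ℂ ι) (hφ : ‖φ‖ = 1)
    (w : J → ℝ) (hw : ∀ j, 0 ≤ w j) (g : J → Fin m → ι) (hg : ∀ j, Function.Injective (g j))
    (hle : ∀ i, ∑ j, w j / m * ∑ k, (if g j k = i then 1 else 0) ≤ ‖φ i‖ ^ 2) :
    ∑ j, w j ∈ distillationProbs m (strictlyIncoherentOps ι (Fin 2 × Fin m)) (ketbra φ) 0 := by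
  have hm0 : (m : ℝ) ≠ 0 := by exact_mod_cast (by omega : m ≠ 0)
  have hφ2 : ∑ i, ‖φ i‖ ^ 2 = 1 := by rw [← EuclideanSpace.norm_sq_eq, hφ, one_pow]
  let c : ι → ℝ := fun i => ∑ j, w j / m * ∑ k, (if g j k = i then 1 else 0)
  have hwm : ∀ j, 0 ≤ w j / m := fun j => div_nonneg (hw j) (Nat.cast_nonneg m)
  have hcount : ∀ j i, (0 : ℝ) ≤ ∑ k, (if g j k = i then 1 else 0) := fun j i =>
    Finset.sum_nonneg fun k _ => by split_ifs <;> norm_num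
  have hc0 : ∀ i, 0 ≤ c i := fun i =>
    Finset.sum_nonneg fun j _ => mul_nonneg (hwm j) (hcount j i)
  have hcsum : ∑ i, c i = ∑ j, w j := by
    simp only [c]
    rw [Finset.sum_comm]
    refine Finset.sum_congr rfl fun j _ => ?_
    rw [← Finset.mul_sum, Finset.sum_comm]
    simp; field_simp
  -- `n i` is the probability of success on the basis state `i`; where `φ i = 0` it is `0 / 0 = 0`.
  let n : ι → ℝ := fun i => c i / ‖φ i‖ ^ 2
  have hn1 : ∀ i, n i ≤ 1 := fun i => div_le_one_of_le₀ (hle i) (sq_nonneg _)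
  have hnc : ∀ i, n i * ‖φ i‖ ^ 2 = c i := fun i => by
    by_cases h : ‖φ i‖ ^ 2 = 0
    · have := hle i
      rw [h] at this ⊢
      rw [mul_zero]; exact le_antisymm (hc0 i) this
    · exact div_mul_cancel₀ _ h
  -- By `hle` the weight of `j` vanishes if `g j` meets a zero of `φ`, so the division by `φ i` in
  -- `Ks` below never spoils an amplitude.
  have hwzero : ∀ j k, φ (g j k) = 0 → w j / m = 0 := fun j k h => by
    refine le_antisymm ?_ (hwm j)
    calc w j / m ≤ w j / m * ∑ k', (if g j k' = g j k then 1 else 0) := by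
          refine le_mul_of_one_le_right (hwm j) ?_
          refine le_trans (by simp) (Finset.single_le_sum
            (f := fun k' => if g j k' = g j k then (1 : ℝ) else 0)
            (fun k' _ => by split_ifs <;> norm_num) (Finset.mem_univ k))
      _ ≤ c (g j k) := Finset.single_le_sum
          (f := fun j' => w j' / m * ∑ k', (if g j' k' = g j k then (1 : ℝ) else 0))
          (fun j' _ => mul_nonneg (hwm j') (hcount j' _)) (Finset.mem_univ j)
      _ ≤ 0 := (hle (g j k)).trans (by simp [h])
  let b₀ : Fin m := ⟨0, hm⟩
  let Ks : J → Matrix (Fin 2 × Fin m) ι ℂ := fun j => Matrix.of fun x i =>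
    if x.1 = 0 ∧ g j x.2 = i then ((√(w j / m) : ℝ) : ℂ) / φ i else 0
  let Kf : ι → Matrix (Fin 2 × Fin m) ι ℂ := fun i₀ => Matrix.of fun x i =>
    if x = (1, b₀) ∧ i₀ = i then ((√(1 - n i) : ℝ) : ℂ) else 0
  have hKs : ∀ j x i, Ks j x i
      = if x.1 = 0 ∧ g j x.2 = i then ((√(w j / m) : ℝ) : ℂ) / φ i else 0 := fun _ _ _ => rfl
  have hKf : ∀ i₀ x i, Kf i₀ x i
      = if x = (1, b₀) ∧ i₀ = i then ((√(1 - n i) : ℝ) : ℂ) else 0 := fun _ _ _ => rfl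
  have htp : ∑ l, (Sum.elim Ks Kf l).conjTranspose * Sum.elim Ks Kf l = 1 := by
    ext i i'
    rw [Matrix.sum_apply, Fintype.sum_sum_type]
    simp only [Sum.elim_inl, Sum.elim_inr, Matrix.mul_apply, Matrix.conjTranspose_apply]
    by_cases hii : i = i'
    · subst hii
      rw [Matrix.one_apply_eq]
      have h1 : ∑ j, ∑ x, star (Ks j x i) * Ks j x i = (n i : ℂ) := by
        simp only [n, c, Finset.sum_div]
        push_cast
        refine Finset.sum_congr rfl fun j _ => ?_
        rw [Fintype.sum_prod_type, Fin.sum_univ_two, Finset.mul_sum, Finset.sum_div]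
        simp only [hKs, ← starRingEnd_apply, Complex.conj_mul']
        simp only [one_ne_zero, false_and, if_false, norm_zero, Complex.ofReal_zero]
        simp only [ne_eq, OfNat.ofNat_ne_zero, not_false_eq_true, zero_pow, Finset.sum_const_zero,
          add_zero, true_and]
        refine Finset.sum_congr rfl fun k _ => ?_
        split_ifs
        · rw [norm_div, Complex.norm_real, Real.norm_of_nonneg (Real.sqrt_nonneg _)]
          push_cast
          rw [div_pow, ← Complex.ofReal_pow, Real.sq_sqrt (hwm j)]
          push_cast; ring
        · simp
      have h2 : ∑ i₀, ∑ x, star (Kf i₀ x i) * Kf i₀ x i = 1 - (n i : ℂ) := by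
        rw [Finset.sum_eq_single i, Finset.sum_eq_single (1, b₀)]
        · simp only [hKf, ← starRingEnd_apply, Complex.conj_mul']
          simp only [and_self, if_true]
          rw [Complex.norm_real, Real.norm_of_nonneg (Real.sqrt_nonneg _), ← Complex.ofReal_pow,
            Real.sq_sqrt (sub_nonneg.mpr (hn1 i))]
          push_cast; rfl
        · intro x _ hx; simp [hKf, hx]
        · simp
        · intro i₀ _ h; simp [hKf, h]
        · simp
      rw [h1, h2]; ring
    · rw [Matrix.one_apply_ne hii]
      have h1 : ∀ j x, star (Ks j x i) * Ks j x i' = 0 := fun j x => by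
        rw [hKs, hKs]; split_ifs with h h' <;> simp
        exact absurd (h.2.symm.trans h'.2) hii
      have h2 : ∀ i₀ x, star (Kf i₀ x i) * Kf i₀ x i' = 0 := fun j x => by
        rw [hKf, hKf]; split_ifs with h h' <;> simp
        exact absurd (h.2.symm.trans h'.2) hii
      simp only [h1, h2, Finset.sum_const_zero, add_zero]
  have hinc : ∀ l, IsIncoherentOperator (Sum.elim Ks Kf l)
      ∧ IsIncoherentOperator (Sum.elim Ks Kf l).conjTranspose := by
    simp only [isIncoherentOperator_iff, Matrix.conjTranspose_apply, star_eq_zero]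
    rintro (j | i₀)
    · simp only [Sum.elim_inl, hKs]
      refine ⟨fun i x y hxy => ?_, fun x i i' hii => ?_⟩
      · by_contra! h
        simp only [ne_eq, ite_eq_right_iff, Classical.not_imp] at h
        refine hxy (Prod.ext (h.1.1.1.trans h.2.1.1.symm) (hg j ?_))
        exact h.1.1.2.trans h.2.1.2.symm
      · by_contra! h
        simp only [ne_eq, ite_eq_right_iff, Classical.not_imp] at h
        exact hii (h.1.1.2.symm.trans h.2.1.2)
    · simp only [Sum.elim_inr, hKf]
      refine ⟨fun i x y hxy => ?_, fun x i i' hii => ?_⟩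
      · by_contra! h
        simp only [ne_eq, ite_eq_right_iff, Classical.not_imp] at h
        exact hxy (h.1.1.1.trans h.2.1.1.symm)
      · by_contra! h
        simp only [ne_eq, ite_eq_right_iff, Classical.not_imp] at h
        exact hii (h.1.1.2.symm.trans h.2.1.2)
  have hKsφ : ∀ j x, (Ks j).mulVec (fun i => φ i) x
      = if x.1 = 0 then ((√(w j / m) : ℝ) : ℂ) else 0 := fun j x => by
    rw [Matrix.mulVec, dotProduct, Finset.sum_eq_single (g j x.2)]
    · rw [hKs]
      by_cases hx : x.1 = 0
      · by_cases h0 : φ (g j x.2) = 0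
        · simp [h0, hwzero j x.2 h0]
        · simp [hx, div_mul_cancel₀ _ h0]
      · simp [hx]
    · intro i _ hi
      simp [hKs, hi.symm]
    · simp
  have hKfφ : ∀ i x, (Kf i).mulVec (fun i => φ i) x
      = if x = (1, b₀) then ((√(1 - n i) : ℝ) : ℂ) * φ i else 0 := fun i x => by
    rw [Matrix.mulVec, dotProduct, Finset.sum_eq_single i]
    · by_cases hx : x = (1, b₀) <;> simp [hKf, hx]
    · intro i' _ hi
      simp [hKf, hi.symm]
    · simp
  have hp1 : ∑ j, w j ≤ 1 := by
    rw [← hcsum, ← hφ2]; exact Finset.sum_le_sum fun i _ => hle i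
  have hsuccess : ∀ x y, ∑ j, (Ks j).mulVec (fun i => φ i) x
      * star ((Ks j).mulVec (fun i => φ i) y)
      = if x.1 = 0 ∧ y.1 = 0 then ((∑ j, w j : ℝ) : ℂ) * (m : ℂ)⁻¹ else 0 := fun x y => by
    simp only [hKsφ]
    split_ifs with hx hy hxy hxy
    · push_cast
      rw [Finset.sum_mul]
      refine Finset.sum_congr rfl fun j _ => ?_
      rw [← starRingEnd_apply, Complex.conj_ofReal, ← Complex.ofReal_mul,
        Real.mul_self_sqrt (hwm j)]
      push_cast; rw [div_eq_mul_inv]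
    all_goals first | tauto | simp
  have hfail : ∀ x y, ∑ i, (Kf i).mulVec (fun i => φ i) x
      * star ((Kf i).mulVec (fun i => φ i) y)
      = if x = (1, b₀) ∧ y = (1, b₀) then ((1 - ∑ j, w j : ℝ) : ℂ) else 0 := fun x y => by
    simp only [hKfφ]
    split_ifs with hx hy hxy hxy
    · have hrest : 1 - ∑ j, w j = ∑ i, (1 - n i) * ‖φ i‖ ^ 2 := by
        simp only [sub_mul, one_mul, hnc, Finset.sum_sub_distrib, hφ2, hcsum]
      rw [hrest, Complex.ofReal_sum]
      refine Finset.sum_congr rfl fun i _ => ?_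
      rw [← starRingEnd_apply, Complex.mul_conj', norm_mul, Complex.norm_real,
        Real.norm_of_nonneg (Real.sqrt_nonneg _), ← Complex.ofReal_pow, mul_pow,
        Real.sq_sqrt (sub_nonneg.mpr (hn1 i))]
    all_goals first | tauto | simp
  refine ⟨Finset.sum_nonneg fun j _ => hw j, hp1, krausMap (Sum.elim Ks Kf),
    krausMap_mem_strictlyIncoherentOps htp hinc, maxCoherentState m, Matrix.single b₀ b₀ 1,
    isDensity_maxCoherentState hm, ?_, ?_, ?_⟩
  · rw [← Matrix.diagonal_single]
    exact ⟨Matrix.PosSemidef.diagonal (Pi.single_nonneg.mpr zero_le_one), by simp⟩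
  · ext x y
    rw [krausMap_apply, Matrix.sum_apply]
    simp only [mul_ketbra_mul_conjTranspose_apply]
    rw [Fintype.sum_sum_type]
    simp only [Sum.elim_inl, Sum.elim_inr]
    rw [hsuccess, hfail, Matrix.add_apply, Matrix.smul_apply, Matrix.smul_apply,
      Matrix.kroneckerMap_apply, Matrix.kroneckerMap_apply, maxCoherentState_apply]
    congr 1
    · simp [Matrix.single_apply, eq_comm]
    · simp only [Matrix.single_apply, Prod.ext_iff, smul_eq_mul]
      grind
  · rw [fidelity_maxCoherentState_self hm, sub_zero]

lemma mem_distillationProbs_of_le_sum_min {d m : ℕ} (hm : 1 ≤ m)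
    (φ : EuclideanSpace ℂ (Fin d)) (hφ : ‖φ‖ = 1) {p : ℝ} (hp : 0 ≤ p)
    (h : p ≤ ∑ i, min (‖φ i‖ ^ 2) (p / m)) :
    p ∈ distillationProbs m (strictlyIncoherentOps (Fin d) (Fin 2 × Fin m)) (ketbra φ) 0 := by
  have hmR : (0 : ℝ) < m := by exact_mod_cast hm
  rcases hp.eq_or_lt with rfl | hp
  · simpa using mem_distillationProbs_strictlyIncoherent (J := Empty) hm φ hφ
      (fun j => j.elim) (fun j => j.elim) (fun j => j.elim) (fun j => j.elim) (by simp)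
  -- Rescaled to total weight `p`, the truncated weights become `p / m` times a hypersimplex point.
  set s := ∑ i, min (‖φ i‖ ^ 2) (p / m) with hs
  have hs0 : 0 < s := hp.trans_le h
  have hmin0 : ∀ i, 0 ≤ min (‖φ i‖ ^ 2) (p / m) := fun i => le_min (sq_nonneg _) (by positivity)
  obtain ⟨w, g, hw0, hw1, hg, hwx⟩ := exists_convexCombination_injections hm
    (fun i => m * min (‖φ i‖ ^ 2) (p / m) / s)
    (fun i => div_nonneg (mul_nonneg hmR.le (hmin0 i)) hs0.le)
    (fun i => by
      rw [div_le_one hs0]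
      calc m * min (‖φ i‖ ^ 2) (p / m) ≤ m * (p / m) := by gcongr; exact min_le_right _ _
        _ = p := by field_simp
        _ ≤ s := h)
    (by rw [← Finset.sum_div, ← Finset.mul_sum, ← hs, mul_div_cancel_right₀ _ hs0.ne'])
  have hsum : ∑ τ, p * w τ = p := by rw [← Finset.mul_sum, hw1, mul_one]
  rw [← hsum]
  refine mem_distillationProbs_strictlyIncoherent hm φ hφ _
    (fun τ => mul_nonneg hp.le (hw0 τ)) g hg fun i => ?_
  calc ∑ τ, p * w τ / m * ∑ k, (if g τ k = i then (1 : ℝ) else 0)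
      = p / m * ∑ τ, w τ * ∑ k, (if g τ k = i then (1 : ℝ) else 0) := by
        rw [Finset.mul_sum]; exact Finset.sum_congr rfl fun τ _ => by ring
    _ = p / s * min (‖φ i‖ ^ 2) (p / m) := by rw [hwx]; field_simp
    _ ≤ min (‖φ i‖ ^ 2) (p / m) := mul_le_of_le_one_left (hmin0 i) ((div_le_one hs0).mpr h)
    _ ≤ ‖φ i‖ ^ 2 := min_le_left _ _

/-! ### The common set of achievable probabilities -/

/-- A class that contains SIO and obeys the converse bound achieves exactly the `p ∈ [0, 1]` within
that bound. -/
lemma distillationProbs_eq {d m : ℕ} (hm : 1 ≤ m) (φ : EuclideanSpace ℂ (Fin d)) (hφ : ‖φ‖ = 1)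
    {O : Set (SuperOp (Fin d) (Fin 2 × Fin m))}
    (hO : strictlyIncoherentOps (Fin d) (Fin 2 × Fin m) ⊆ O)
    (hconv : ∀ p ∈ distillationProbs m O (ketbra φ) 0, p ≤ ∑ i, min (‖φ i‖ ^ 2) (p / m)) :
    distillationProbs m O (ketbra φ) 0
      = {p | p ∈ Set.Icc 0 1 ∧ p ≤ ∑ i, min (‖φ i‖ ^ 2) (p / m)} := by
  refine Set.Subset.antisymm (fun p hp => ⟨⟨hp.1, hp.2.1⟩, hconv p hp⟩) fun p hp => ?_
  exact distillationProbs_mono hO _ _ (mem_distillationProbs_of_le_sum_min hm φ hφ hp.1.1 hp.2)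

lemma isGreatest_sSup_le_sum_min {ι : Type*} [Fintype ι] (m : ℕ) (a : ι → ℝ) (ha : ∀ i, 0 ≤ a i) :
    IsGreatest {p : ℝ | p ∈ Set.Icc 0 1 ∧ p ≤ ∑ i, min (a i) (p / m)}
      (sSup {p : ℝ | p ∈ Set.Icc 0 1 ∧ p ≤ ∑ i, min (a i) (p / m)}) := by
  refine IsCompact.isGreatest_sSup (isCompact_Icc.inter_right
    (isClosed_le continuous_id (by fun_prop))) ⟨0, ⟨⟨le_rfl, zero_le_one⟩, ?_⟩⟩
  simpa using Finset.sum_nonneg fun i _ => le_min (ha i) le_rfl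

end Coherence

theorem mainTheorem2 (d m : ℕ) (hm : 1 ≤ m) (φ : EuclideanSpace ℂ (Fin d)) (hφ : ‖φ‖ = 1) :
    (IsGreatest
        (Coherence.distillationProbs m (Coherence.dephasingCovariantOps (Fin d) (Fin 2 × Fin m))
          (Coherence.ketbra φ) 0)
        (Coherence.maxSuccessProb m (Coherence.dephasingCovariantOps (Fin d) (Fin 2 × Fin m))
          (Coherence.ketbra φ) 0) ∧
      IsGreatest
        (Coherence.distillationProbs m (Coherence.strictlyIncoherentOps (Fin d) (Fin 2 × Fin m))
          (Coherence.ketbra φ) 0)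
        (Coherence.maxSuccessProb m (Coherence.strictlyIncoherentOps (Fin d) (Fin 2 × Fin m))
          (Coherence.ketbra φ) 0) ∧
      IsGreatest
        (Coherence.distillationProbs m (Coherence.incoherentOps (Fin d) (Fin 2 × Fin m))
          (Coherence.ketbra φ) 0)
        (Coherence.maxSuccessProb m (Coherence.incoherentOps (Fin d) (Fin 2 × Fin m))
          (Coherence.ketbra φ) 0)) ∧
    Coherence.maxSuccessProb m (Coherence.dephasingCovariantOps (Fin d) (Fin 2 × Fin m))
        (Coherence.ketbra φ) 0
      = Coherence.maxSuccessProb m (Coherence.strictlyIncoherentOps (Fin d) (Fin 2 × Fin m))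
          (Coherence.ketbra φ) 0 ∧
    Coherence.maxSuccessProb m (Coherence.dephasingCovariantOps (Fin d) (Fin 2 × Fin m))
        (Coherence.ketbra φ) 0
      = Coherence.maxSuccessProb m (Coherence.incoherentOps (Fin d) (Fin 2 × Fin m))
          (Coherence.ketbra φ) 0 := by
  have hS := Coherence.distillationProbs_eq hm φ hφ subset_rfl fun p hp =>
    Coherence.le_sum_min_of_mem_incoherent hm φ (Coherence.distillationProbs_mono
      (Coherence.strictlyIncoherentOps_subset_incoherentOps _ _) _ _ hp)
  have hI := Coherence.distillationProbs_eq hm φ hφ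
    (Coherence.strictlyIncoherentOps_subset_incoherentOps _ _) fun p hp =>
      Coherence.le_sum_min_of_mem_incoherent hm φ hp
  have hD := Coherence.distillationProbs_eq hm φ hφ
    (Coherence.strictlyIncoherentOps_subset_dephasingCovariantOps _ _) fun p hp =>
      Coherence.le_sum_min_of_mem_dephasingCovariant hm φ hp
  have hmax := Coherence.isGreatest_sSup_le_sum_min m (fun i => ‖φ i‖ ^ 2) fun i => sq_nonneg _
  simp only [Coherence.maxSuccessProb]
  rw [hS, hI, hD]
  exact ⟨⟨hmax, hmax, hmax⟩, rfl, rfl⟩
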